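/- Let $p$ be a prime and let $G$ be a group of order $p^n$ and nilpotency class $2$ that is a Camina group, i.e. every conjugacy class of $G$ not contained in $G'=[G,G]$ is a coset of $G'$. Let $|Z(G)|=p^k$. For a conjugacy class $C$ of $G$ let $A_C$ be the complex $G\times G$ matrix with $(A_C)_{x,y}=1$ if $yx^{-1}\in C$ and $0$ otherwise, and let $E_C^*$ be the diagonal matrix with $(E_C^*)_{x,x}=1$ if $x\in C$ and $0$ otherwise. The Terwilliger algebra $T(G)$ is the subalgebra of the complex $G\times G$ matrices generated by all $A_C$ and $E_C^*$. Its primary module is the submodule $T(G)\hat e$ of $\mathbb{C}^G$ generated by the characteristic vector $\hat e$ of the identity of $G$, and its primary component $V$ is the sum of all left ideals of $T(G)$ isomorphic to the primary module. There are exactly $p^{n-k}-1$ conjugacy classes $C_1,\dots,C_{p^{n-k}-1}$ of $G$ not contained in $G'$, and $Z(G)$ can be generated by $k$ elements. Let $Z(G)=\langle z_1,\dots,z_k\rangle$ be any such choice of generators, let $\zeta\in\mathbb{C}$ be any primitive $p$th root of unity, and for $\alpha=(\alpha_1,\dots,\alpha_k)\in\{0,1,\dots,p-1\}^k$ put $$W_i(\alpha)=\frac{1}{p^k}\sum_{a_1,\dots,a_k\in\{0,\dots,p-1\}}\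 \prod_{j=1}^k \zeta^{\alpha_ja_j}\bigl(E_{C_i}^*A_{\{z_j\}}E_{C_i}^*\bigr)^{a_j}\in T(G),$$ where powers are taken in the algebra $E_{C_i}^*T(G)E_{C_i}^*$, so that a zeroth power is $E_{C_i}^*$. Let $\mathcal{W}_i(\alpha)$ be the two-sided ideal of $T(G)$ generated by $W_i(\alpha)$. Then the Wedderburn decomposition of $T(G)$ is $$T(G)=V\oplus\bigoplus_{i=1}^{p^{n-k}-1}\ \bigoplus_{\alpha\in\{0,\dots,p-1\}^k,\ \alpha\ne 0}\mathcal{W}_i(\alpha),$$ that is, $T(G)$ is the internal direct sum of these ideals and each of them is a minimal nonzero two-sided ideal; moreover each $\mathcal{W}_i(\alpha)$ with $\alpha\ne0$ is one-dimensional over $\mathbb{C}$. -/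

import Mathlib

open scoped Pointwise

noncomputable section

namespace GroupScheme

/-- A conjugacy class lies outside the derived subgroup. -/
def IsOutside {G : Type*} [Group G] (c : ConjClasses G) : Prop :=
  ¬ c.carrier ⊆ (commutator G : Set G)

/-- A Camina group: every conjugacy class outside `G'` is a coset of `G'`. -/
def IsCamina (G : Type*) [Group G] : Prop :=
  ∀ c : ConjClasses G, IsOutside c → ∃ g : G, c.carrier = g • (commutator G : Set G)

/-- The relation `{(x, y) | y x⁻¹ ∈ c}` of the group association scheme. -/
def rel {G : Type*} [Group G] (c : ConjClasses G) (x y : G) : Prop :=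
  y * x⁻¹ ∈ c.carrier

open Classical in
/-- The adjacency matrix of the relation of the class `c`. -/
def adjMatrix {G : Type*} [Group G] (c : ConjClasses G) : Matrix G G ℂ :=
  Matrix.of fun x y => if rel c x y then 1 else 0

open Classical in
/-- The dual idempotent of the class `c`, with base point the identity: the diagonal matrix
whose `(x, x)` entry is `1` if `(1, x)` lies in the relation of `c`, and `0` otherwise. -/
def dualIdempotentMatrix {G : Type*} [Group G] [DecidableEq G] (c : ConjClasses G) :
    Matrix G G ℂ :=
  Matrix.diagonal fun x => if rel c 1 x then 1 else 0

variable (G : Type*) [Group G] [Fintype G] [DecidableEq G]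

/-- The Terwilliger algebra `T(G)` of the group association scheme, with base point the identity:
the algebra generated by the adjacency matrices and the dual idempotents. -/
abbrev terwilligerAlgebra : Subalgebra ℂ (Matrix G G ℂ) :=
  Algebra.adjoin ℂ (Set.range adjMatrix ∪ Set.range dualIdempotentMatrix)

/-- The primary module of `T(G)`: the submodule of the standard module `ℂ^G` generated by
the characteristic vector of the base point. -/
def primaryModule : Submodule (terwilligerAlgebra G) (G → ℂ) :=
  Submodule.span (terwilligerAlgebra G) {Pi.single (1 : G) (1 : ℂ)}

/-- The primary component of `T(G)`: the sum of all left ideals of `T(G)` which, as modules, are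
isomorphic to the primary module. -/
def primaryComponent : Ideal (terwilligerAlgebra G) :=
  isotypicComponent (terwilligerAlgebra G) (terwilligerAlgebra G) (primaryModule G)

variable {G}

/-- The adjacency matrix of `c` as an element of `T(G)`. -/
def adj (c : ConjClasses G) : terwilligerAlgebra G :=
  ⟨adjMatrix c, Algebra.subset_adjoin (Or.inl ⟨c, rfl⟩)⟩

/-- The dual idempotent of `c` as an element of `T(G)`. -/
def dualIdempotent (c : ConjClasses G) : terwilligerAlgebra G :=
  ⟨dualIdempotentMatrix c, Algebra.subset_adjoin (Or.inr ⟨c, rfl⟩)⟩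

/-- The element
`W_c(α) = p⁻ᵏ ∑_a ∏_j ζ ^ (α_j a_j) (E_c^* A_{z_j} E_c^*) ^ (a_j)` of `T(G)`, where `a` ranges over
`{0, …, p - 1}ᵏ`. The powers are taken in the corner `E_c^* T(G) E_c^*`, whose unit is `E_c^*`
(so that a zeroth power is `E_c^*`); this is what the left factor `E_c^*` achieves. -/
def W {k : ℕ} (p : ℕ) (ζ : ℂ) (z : Fin k → G) (c : ConjClasses G) (α : Fin k → Fin p) :
    terwilligerAlgebra G :=
  ((p : ℂ) ^ k)⁻¹ • ∑ a : Fin k → Fin p,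
    dualIdempotent c * (List.ofFn fun j : Fin k =>
      ζ ^ ((α j : ℕ) * (a j : ℕ)) •
        (dualIdempotent c * adj (ConjClasses.mk (z j)) * dualIdempotent c) ^ (a j : ℕ)).prod

/-- The two-sided ideal of `T(G)` generated by `W_c(α)`. -/
def WIdeal {k : ℕ} (p : ℕ) (ζ : ℂ) (z : Fin k → G) (c : ConjClasses G) (α : Fin k → Fin p) :
    Ideal (terwilligerAlgebra G) :=
  TwoSidedIdeal.asIdeal (TwoSidedIdeal.span {W p ζ z c α})

open Classical in
/-- A Wedderburn decomposition of a ring: it is the internal direct sum of the members of the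
family, each of which is a minimal nonzero two-sided ideal. -/
structure IsWedderburnDecomposition {A ι : Type*} [Ring A] (I : ι → Ideal A) : Prop where
  minimal : ∀ i, Minimal (fun J : Ideal A => J.IsTwoSided ∧ J ≠ ⊥) (I i)
  isInternal : DirectSum.IsInternal I

/-- The family consisting of the primary component `V` (index `none`) and of the ideals
generated by the `W_c(α)`, for the classes `c` outside `G'` and the `α ≠ 0`. -/
def components {k : ℕ} (p : ℕ) (ζ : ℂ) (z : Fin k → G) :
    Option ({c : ConjClasses G // IsOutside c} ×
      {α : Fin k → Fin p // ∃ j, (α j : ℕ) ≠ 0}) → Ideal (terwilligerAlgebra G)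
  | none => primaryComponent G
  | some (c, α) => WIdeal p ζ z c.1 α.1

end GroupScheme

end

noncomputable section

namespace GroupScheme

/-! ### Camina groups of class two: centre, classes, exponent. -/

section Camina

variable {G : Type*} [Group G]

/-! Class two and the Camina condition force `Z(G) = G'`, so the classes are the points of the
centre `Z` and the nontrivial cosets of `Z`. Moreover `Z` has exponent `p`. Thus `Z` is elementary
abelian of rank `k`, any `k` generators form a basis, and the tuples `α` enumerate the characters
`χ_α` of `Z`. This identifies `W_c(α)` with `charIdempotent`, the element `|Z|⁻¹ ∑_z χ_α(z) E_c^*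
A_z`.

For nontrivial `χ`, every generator of `T(G)` acts on this element by a scalar, from either side:
`A_z` with `z` central by `χ(z)⁻¹`, a dual idempotent by `0` or `1`, and `A_d` with `d` outside `Z`
by `0`, because `A_d` absorbs every `A_z` and `∑ χ(z) = 0`. The element therefore spans a two-sided
ideal and is a central idempotent (`IsCamina.mul_charIdempotent`, `IsCamina.charIdempotent_comm`).

For trivial `χ` the element is the normalized all-ones block on `c × c`
(`IsCamina.charIdempotent_one`). Since the elements of all characters sum to `E_c^*`, removing the
nontrivial ones from `1` leaves the sum of the normalized diagonal blocks over all classes. Blocks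
multiply like matrix units up to nonzero scalars, so this idempotent cuts out a simple ideal
(`primaryComponent_minimal`), and that ideal is the primary component (`mem_primaryComponent_iff`).
Complete orthogonal central idempotents then give the decomposition. -/

lemma mem_carrier_mk_of_mem_center {z x : G} (hz : z ∈ Subgroup.center G) :
    x ∈ (ConjClasses.mk z).carrier ↔ x = z := by
  rw [ConjClasses.mem_carrier_iff_mk_eq, ConjClasses.mk_eq_mk_iff_isConj, isConj_comm,
    isConj_iff]
  constructor
  · rintro ⟨c, rfl⟩
    rw [Subgroup.mem_center_iff.mp hz c, mul_inv_cancel_right]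
  · rintro rfl
    exact ⟨1, by simp⟩

lemma commutator_le_center_of_nilpotencyClass [Group.IsNilpotent G]
    (h : Group.nilpotencyClass G = 2) : commutator G ≤ Subgroup.center G := by
  have h2 : Subgroup.upperCentralSeries G 2 = ⊤ := h ▸ Subgroup.upperCentralSeries_nilpotencyClass
  rw [commutator_def, Subgroup.commutator_le]
  intro a _ b _
  have ha : a ∈ Subgroup.upperCentralSeries G (1 + 1) := h2 ▸ Subgroup.mem_top a
  have := (Subgroup.mem_upperCentralSeries_succ_iff.mp ha) b
  rwa [Subgroup.upperCentralSeries_one] at this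

lemma commutator_ne_bot_of_nilpotencyClass [Group.IsNilpotent G]
    (h : Group.nilpotencyClass G = 2) : commutator G ≠ ⊥ := by
  intro hb
  have := (Subgroup.lowerCentralSeries_eq_bot_iff_nilpotencyClass_le (G := G) (n := 1)).mp
    (by rw [Subgroup.top_lowerCentralSeries_one, hb])
  omega

/-- A central class is a single point, whereas a coset of `G' ≠ 1` is not. -/
lemma IsCamina.center_le_commutator (hG : IsCamina G) (h : commutator G ≠ ⊥) :
    Subgroup.center G ≤ commutator G := by
  intro z hz
  by_contra hzc
  obtain ⟨g, hg⟩ := hG (ConjClasses.mk z) fun hsub => hzc (hsub ConjClasses.mem_carrier_mk)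
  apply h
  rw [Subgroup.eq_bot_iff_forall]
  intro x hx
  have key : ∀ y ∈ commutator G, g * y = z := fun y hy =>
    (mem_carrier_mk_of_mem_center hz).mp (hg ▸ ⟨y, hy, rfl⟩)
  exact mul_left_cancel ((key x hx).trans (key 1 (one_mem _)).symm)

lemma isOutside_mk_iff (h : Subgroup.center G = commutator G) (g : G) :
    IsOutside (ConjClasses.mk g) ↔ g ∉ Subgroup.center G := by
  constructor
  · intro hout hg
    refine hout fun x hx => ?_
    rw [(mem_carrier_mk_of_mem_center hg).mp hx]
    exact h ▸ hg
  · intro hg hsub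
    exact hg (h ▸ hsub ConjClasses.mem_carrier_mk)

lemma IsCamina.mem_carrier_iff (hG : IsCamina G) (h : Subgroup.center G = commutator G)
    {c : ConjClasses G} (hc : IsOutside c) {x y : G} (hx : x ∈ c.carrier) :
    y ∈ c.carrier ↔ y * x⁻¹ ∈ Subgroup.center G := by
  obtain ⟨g, hg⟩ := hG c hc
  rw [hg, ← h, Set.mem_smul_set_iff_inv_smul_mem] at hx
  rw [hg, ← h, Set.mem_smul_set_iff_inv_smul_mem]
  simp only [smul_eq_mul, SetLike.mem_coe] at hx ⊢
  rw [Subgroup.Normal.mem_comm_iff inferInstance (a := y) (b := x⁻¹),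
    show x⁻¹ * y = (g⁻¹ * x)⁻¹ * (g⁻¹ * y) by group, mul_mem_cancel_left (inv_mem hx)]

lemma IsCamina.mem_carrier_mul_iff (hG : IsCamina G) (hZ : Subgroup.center G = commutator G)
    {c : ConjClasses G} (hc : IsOutside c) {z : G}
    (hz : z ∈ Subgroup.center G) (x : G) : z * x ∈ c.carrier ↔ x ∈ c.carrier := by
  constructor
  · intro h
    refine (hG.mem_carrier_iff hZ hc h).mpr ?_
    simpa using hz
  · intro h
    refine (hG.mem_carrier_iff hZ hc h).mpr ?_
    simpa using hz

lemma exists_eq_mk_of_not_isOutside (h : Subgroup.center G = commutator G)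
    {c : ConjClasses G} (hc : ¬ IsOutside c) : ∃ z ∈ Subgroup.center G, c = ConjClasses.mk z := by
  induction c using Quotient.inductionOn with
  | _ g => exact ⟨g, not_not.mp ((isOutside_mk_iff h g).not.mp hc), rfl⟩

/-- The classes outside the centre correspond to the nontrivial elements of the central
quotient. -/
lemma IsCamina.card_isOutside [Finite G] (hG : IsCamina G)
    (h : Subgroup.center G = commutator G) :
    Nat.card {c : ConjClasses G // IsOutside c} = Nat.card (G ⧸ Subgroup.center G) - 1 := by
  have hb : Function.Bijective (fun q : {q : G ⧸ Subgroup.center G // q ≠ 1} =>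
      (⟨ConjClasses.mk q.1.out, (isOutside_mk_iff h _).mpr fun hq => q.2 (by
        rw [← QuotientGroup.out_eq' q.1]; exact (QuotientGroup.eq_one_iff _).mpr hq)⟩ :
        {c : ConjClasses G // IsOutside c})) := by
    constructor
    · intro q r hqr
      have h1 : ConjClasses.mk q.1.out = ConjClasses.mk r.1.out := congrArg Subtype.val hqr
      have hr : IsOutside (ConjClasses.mk r.1.out) := (isOutside_mk_iff h _).mpr fun hq => r.2 (by
        rw [← QuotientGroup.out_eq' r.1]; exact (QuotientGroup.eq_one_iff _).mpr hq)
      have h2 := (hG.mem_carrier_iff h hr ConjClasses.mem_carrier_mk).mp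
        (ConjClasses.mem_carrier_iff_mk_eq.mpr h1)
      rw [Subgroup.Normal.mem_comm_iff inferInstance, ← QuotientGroup.eq,
        QuotientGroup.out_eq', QuotientGroup.out_eq'] at h2
      exact Subtype.ext h2.symm
    · rintro ⟨c, hc⟩
      induction c using Quotient.inductionOn with
      | _ g =>
      have hg := (isOutside_mk_iff h g).mp hc
      refine ⟨⟨(g : G ⧸ Subgroup.center G), fun h1 => hg ((QuotientGroup.eq_one_iff _).mp h1)⟩, ?_⟩
      apply Subtype.ext
      refine ConjClasses.mem_carrier_iff_mk_eq.mp ?_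
      refine (hG.mem_carrier_iff h hc (x := g) ConjClasses.mem_carrier_mk).mpr ?_
      rw [Subgroup.Normal.mem_comm_iff inferInstance, ← QuotientGroup.eq, QuotientGroup.out_eq']
  rw [← Nat.card_congr (Equiv.ofBijective _ hb)]
  have := Fintype.ofFinite (G ⧸ Subgroup.center G)
  classical
  rw [Nat.card_eq_fintype_card, Nat.card_eq_fintype_card, Fintype.card_subtype_compl,
    Fintype.card_subtype_eq]

/-- In a Camina `p`-group of class two the centre has exponent `p`. -/
lemma IsCamina.pow_eq_one_of_mem_center {p : ℕ} [Fact p.Prime] (hp : IsPGroup p G)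
    (hG : IsCamina G) (h : Subgroup.center G = commutator G) (hne : ∃ g : G, g ∉ Subgroup.center G)
    {z : G} (hz : z ∈ Subgroup.center G) : z ^ p = 1 := by
  -- Among the powers `g ^ p ^ m` of a noncentral `g`, take the last one before they first enter the
  -- centre.
  obtain ⟨x, hx, hxp⟩ : ∃ x : G, x ∉ Subgroup.center G ∧ x ^ p ∈ Subgroup.center G := by
    obtain ⟨g, hg⟩ := hne
    obtain ⟨m, hm⟩ := hp g
    have hex : ∃ m, g ^ p ^ m ∈ Subgroup.center G := ⟨m, hm ▸ one_mem _⟩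
    classical
    have hpos : Nat.find hex ≠ 0 := fun h0 => hg (by simpa [h0] using Nat.find_spec hex)
    obtain ⟨l, hl⟩ := Nat.exists_eq_succ_of_ne_zero hpos
    refine ⟨g ^ p ^ l, Nat.find_min hex (by omega), ?_⟩
    rw [← pow_mul, ← pow_succ]
    simpa [hl] using Nat.find_spec hex
  have hout := (isOutside_mk_iff h x).mpr hx
  -- The class of `x` is its full coset of the centre, so `z * x` is conjugate to `x`; as `x ^ p` is
  -- central, both have the same `p`-th power.
  have hzx : z * x ∈ (ConjClasses.mk x).carrier :=
    (hG.mem_carrier_iff h hout (x := x) ConjClasses.mem_carrier_mk).mpr (by simpa using hz)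
  obtain ⟨g, hg⟩ := isConj_iff.mp (ConjClasses.mk_eq_mk_iff_isConj.mp
    (ConjClasses.mem_carrier_iff_mk_eq.mp hzx).symm)
  have h1 : (z * x) ^ p = x ^ p := by
    rw [← hg, conj_pow, Subgroup.mem_center_iff.mp hxp g, mul_inv_cancel_right]
  rwa [(show Commute z x from (Subgroup.mem_center_iff.mp hz x).symm).mul_pow, mul_eq_right] at h1

end Camina

/-! ### Coordinates and characters of elementary abelian groups. -/

section Characters

variable {A : Type*} [CommGroup A] {p k : ℕ} [Fact p.Prime]

/-- An elementary abelian group of order `p ^ k` has a generating family of length `k`. -/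
lemma exists_closure_range_eq_top [Finite A] (hA : ∀ x : A, x ^ p = 1)
    (hcard : Nat.card A = p ^ k) : ∃ z : Fin k → A, Subgroup.closure (Set.range z) = ⊤ := by
  let : Module (ZMod p) (Additive A) := AddCommGroup.zmodModule (n := p) fun x => hA x.toMul
  have : Module.Finite (ZMod p) (Additive A) := Module.Finite.of_finite
  have hr : Module.finrank (ZMod p) (Additive A) = k := by
    have h1 := Module.natCard_eq_pow_finrank (K := ZMod p) (V := Additive A)
    rw [Nat.card_zmod] at h1
    exact Nat.pow_right_injective (Fact.out : p.Prime).two_le (h1.symm.trans hcard)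
  let b := Module.finBasisOfFinrankEq (ZMod p) (Additive A) hr
  refine ⟨fun i => (b i).toMul, (Subgroup.eq_top_iff' _).mpr fun x => ?_⟩
  have hx := congrArg Additive.toMul (b.sum_repr (Additive.ofMul x))
  rw [toMul_sum, toMul_ofMul] at hx
  rw [← hx]
  refine Subgroup.prod_mem _ fun i _ => ?_
  rw [← ZMod.natCast_zmod_val (b.repr (Additive.ofMul x) i), Nat.cast_smul_eq_nsmul, toMul_nsmul]
  exact pow_mem (Subgroup.subset_closure (Set.mem_range_self i)) _

/-- The coordinates of an elementary abelian group of order `p ^ k` with respect to a generating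
family of length `k`, and the resulting characters. -/
lemma exists_characters [Finite A] (hA : ∀ x : A, x ^ p = 1) (hcard : Nat.card A = p ^ k)
    {z : Fin k → A} (hz : Subgroup.closure (Set.range z) = ⊤) {ζ : ℂ} (hζ : IsPrimitiveRoot ζ p) :
    Function.Bijective (fun a : Fin k → Fin p => ∏ j, z j ^ (a j : ℕ)) ∧
    ∃ χ : (Fin k → Fin p) → A →* ℂˣ, ∀ α a : Fin k → Fin p,
      (χ α (∏ j, z j ^ (a j : ℕ)) : ℂ) = ∏ j, ζ ^ ((α j : ℕ) * (a j : ℕ)) := by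
  let : Module (ZMod p) (Additive A) := AddCommGroup.zmodModule (n := p) fun x => hA x.toMul
  have : Module.Finite (ZMod p) (Additive A) := Module.Finite.of_finite
  have hr : Module.finrank (ZMod p) (Additive A) = k := by
    have h1 := Module.natCard_eq_pow_finrank (K := ZMod p) (V := Additive A)
    rw [Nat.card_zmod] at h1
    exact Nat.pow_right_injective (Fact.out : p.Prime).two_le (h1.symm.trans hcard)
  have hspan : ⊤ ≤ Submodule.span (ZMod p) (Set.range fun i => Additive.ofMul (z i)) := by
    intro x _
    have hx : x.toMul ∈ Subgroup.closure (Set.range z) := hz ▸ Subgroup.mem_top _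
    change Additive.ofMul x.toMul ∈ _
    generalize x.toMul = x at hx
    induction hx using Subgroup.closure_induction with
    | mem y hy =>
      obtain ⟨i, rfl⟩ := hy
      exact Submodule.subset_span ⟨i, rfl⟩
    | one => exact Submodule.zero_mem _
    | mul y w _ _ hy hw => exact Submodule.add_mem _ hy hw
    | inv y _ hy => exact Submodule.neg_mem _ hy
  -- Spanning by `k` vectors in dimension `k` over `ZMod p` already gives a basis.
  let b := basisOfTopLeSpanOfCardEqFinrank _ hspan (by rw [hr, Fintype.card_fin])
  have hb : ∀ i, b i = Additive.ofMul (z i) := fun i => by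
    simp [b, coe_basisOfTopLeSpanOfCardEqFinrank]
  have hrepr : ∀ (a : Fin k → Fin p) j,
      b.repr (Additive.ofMul (∏ j, z j ^ (a j : ℕ))) j = ((a j : ℕ) : ZMod p) := by
    intro a j
    have h1 : Additive.ofMul (∏ j, z j ^ (a j : ℕ)) = ∑ j, ((a j : ℕ) : ZMod p) • b j := by
      simp only [hb, Nat.cast_smul_eq_nsmul, ofMul_prod, ofMul_pow]
    rw [h1, b.repr_sum_self]
  have hval : ∀ a : Fin p, ((a : ℕ) : ZMod p).val = a := fun a => ZMod.val_cast_of_lt a.2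
  refine ⟨?_, ?_⟩
  · have := Fintype.ofFinite A
    rw [Fintype.bijective_iff_injective_and_card]
    refine ⟨fun a a' haa => ?_, ?_⟩
    · funext j
      apply Fin.ext
      rw [← hval (a j), ← hval (a' j), ← hrepr, ← hrepr]
      exact congrArg (fun x => (b.repr (Additive.ofMul x) j).val) haa
    · rw [← Nat.card_eq_fintype_card (α := A), hcard]
      simp
  · let ψ := AddChar.zmodChar p hζ.pow_eq_one
    let f : (Fin k → Fin p) → A →* ℂ := fun α =>
      { toFun := fun x => ∏ j, ψ (b.repr (Additive.ofMul x) j) ^ (α j : ℕ)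
        map_one' := by simp
        map_mul' := fun x y => by
          simp [AddChar.map_add_eq_mul, mul_pow, Finset.prod_mul_distrib] }
    refine ⟨fun α => (f α).toHomUnits, fun α a => ?_⟩
    rw [MonoidHom.coe_toHomUnits]
    change ∏ j, ψ (b.repr (Additive.ofMul (∏ j, z j ^ (a j : ℕ))) j) ^ (α j : ℕ) = _
    refine Finset.prod_congr rfl fun j _ => ?_
    rw [hrepr, AddChar.zmodChar_apply, hval, ← pow_mul, mul_comm]

/-- The sum factors over the coordinates; a coordinate with `a j ≠ 0` contributes the full geometric
sum of the primitive root `ζ ^ a j`, which vanishes. -/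
lemma characters_sum [DecidableEq A] {z : Fin k → A} {ζ : ℂ} (hζ : IsPrimitiveRoot ζ p)
    (hz : Function.Bijective (fun a : Fin k → Fin p => ∏ j, z j ^ (a j : ℕ)))
    {χ : (Fin k → Fin p) → A →* ℂˣ} (hχ : ∀ α a : Fin k → Fin p,
      (χ α (∏ j, z j ^ (a j : ℕ)) : ℂ) = ∏ j, ζ ^ ((α j : ℕ) * (a j : ℕ))) (x : A) :
    ∑ α, (χ α x : ℂ) = if x = 1 then (p : ℂ) ^ k else 0 := by
  have hp : p.Prime := Fact.out
  have : NeZero p := ⟨hp.ne_zero⟩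
  obtain ⟨a, rfl⟩ := hz.2 x
  have h1 : (1 : A) = ∏ j, z j ^ (((0 : Fin k → Fin p) j : Fin p) : ℕ) := by simp
  have h2 : (∏ j, z j ^ (a j : ℕ) = 1) ↔ a = 0 := by
    rw [h1]
    exact hz.1.eq_iff (a := a) (b := 0)
  simp only [hχ, h2]
  rw [← Fintype.prod_sum (fun j (t : Fin p) => ζ ^ ((t : ℕ) * (a j : ℕ)))]
  split_ifs with ha
  · simp [ha]
  · obtain ⟨j, hj⟩ := Function.ne_iff.mp ha
    refine Finset.prod_eq_zero (Finset.mem_univ j) ?_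
    have h3 : IsPrimitiveRoot (ζ ^ (a j : ℕ)) p :=
      hζ.pow_of_coprime _ (Nat.Coprime.symm ((Nat.Prime.coprime_iff_not_dvd hp).mpr
        fun h0 => hj (Fin.ext (by simpa using Nat.eq_zero_of_dvd_of_lt h0 (a j).2))))
    have h4 := h3.geom_sum_eq_zero hp.one_lt
    rw [Finset.sum_range] at h4
    simpa only [← pow_mul, mul_comm] using h4

/-- Evaluation at the `i`-th generator gives `ζ ^ α i`, which determines `α i < p`. -/
lemma characters_injective {z : Fin k → A} {ζ : ℂ} (hζ : IsPrimitiveRoot ζ p)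
    {χ : (Fin k → Fin p) → A →* ℂˣ} (hχ : ∀ α a : Fin k → Fin p,
      (χ α (∏ j, z j ^ (a j : ℕ)) : ℂ) = ∏ j, ζ ^ ((α j : ℕ) * (a j : ℕ))) :
    Function.Injective χ := by
  have hp : p.Prime := Fact.out
  have : NeZero p := ⟨hp.ne_zero⟩
  intro α β h
  funext i
  have h1 := (hχ α (Pi.single i ⟨1, hp.one_lt⟩)).symm.trans
    ((congrArg (fun f : A →* ℂˣ => ((f _ : ℂˣ) : ℂ)) h).trans (hχ β (Pi.single i ⟨1, hp.one_lt⟩)))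
  have h2 : ∀ γ : Fin k → Fin p, ∏ j, ζ ^ ((γ j : ℕ) *
      ((Pi.single i ⟨1, hp.one_lt⟩ : Fin k → Fin p) j : ℕ)) = ζ ^ (γ i : ℕ) := fun γ => by
    rw [Finset.prod_eq_single i]
    · simp
    · intro j _ hj
      simp [hj]
    · simp
  rw [h2, h2] at h1
  exact Fin.ext (hζ.pow_inj (α i).2 (β i).2 h1)

end Characters

open Matrix

/-! ### All-ones blocks and the primary component. -/

section Blocks

variable {G : Type*} [Group G]

open Classical in
/-- The characteristic vector of a conjugacy class. -/
def classVec (c : ConjClasses G) : G → ℂ := fun x => if x ∈ c.carrier then 1 else 0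

lemma classVec_of_mem {c : ConjClasses G} {x : G} (h : x ∈ c.carrier) : classVec c x = 1 :=
  if_pos h

lemma classVec_of_not_mem {c : ConjClasses G} {x : G} (h : x ∉ c.carrier) : classVec c x = 0 :=
  if_neg h

open Classical in
lemma classVec_mul_classVec (c d : ConjClasses G) (x : G) :
    classVec c x * classVec d x = if c = d then classVec c x else 0 := by
  by_cases hx : x ∈ c.carrier
  · rw [classVec_of_mem hx, one_mul]
    rw [ConjClasses.mem_carrier_iff_mk_eq] at hx
    simp only [classVec, ConjClasses.mem_carrier_iff_mk_eq, hx]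
  · simp [classVec_of_not_mem hx]

lemma exists_classVec_eq_one (c : ConjClasses G) : ∃ x, classVec c x = 1 := by
  induction c using Quotient.inductionOn with
  | _ g => exact ⟨g, classVec_of_mem ConjClasses.mem_carrier_mk⟩

lemma classVec_one : classVec (1 : ConjClasses G) 1 = 1 :=
  classVec_of_mem ConjClasses.mem_carrier_mk

lemma sum_classVec [Fintype (ConjClasses G)] (x : G) : ∑ c, classVec c x = 1 := by
  classical
  simp [classVec, ConjClasses.mem_carrier_iff_mk_eq]

lemma adjMatrix_apply (c : ConjClasses G) (x y : G) :
    adjMatrix c x y = classVec c (y * x⁻¹) := rfl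

lemma adjMatrix_mk_apply [DecidableEq G] {z : G} (hz : z ∈ Subgroup.center G) (x y : G) :
    adjMatrix (ConjClasses.mk z) x y = if y = z * x then 1 else 0 := by
  classical
  rw [adjMatrix_apply, classVec]
  exact if_congr ((mem_carrier_mk_of_mem_center hz).trans mul_inv_eq_iff_eq_mul) rfl rfl

lemma dualIdempotentMatrix_eq [DecidableEq G] (c : ConjClasses G) :
    dualIdempotentMatrix c = diagonal (classVec c) := by
  classical
  refine congrArg diagonal (funext fun x => if_congr ?_ rfl rfl)
  simp [rel]

lemma single_eq_classVec [DecidableEq G] : (Pi.single (1 : G) (1 : ℂ) : G → ℂ) = classVec (1 : ConjClasses G) := by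
  ext x
  rw [Pi.single_apply]
  classical
  exact (if_congr (mem_carrier_mk_of_mem_center (one_mem _)) rfl rfl).symm

lemma IsCamina.classVec_mul (hG : IsCamina G) (hZ : Subgroup.center G = commutator G)
    {c : ConjClasses G} (hc : IsOutside c) {z : G}
    (hz : z ∈ Subgroup.center G) (x : G) : classVec c (z * x) = classVec c x := by
  classical
  exact if_congr (hG.mem_carrier_mul_iff hZ hc hz x) rfl rfl

section Card

variable [Fintype G]

/-- The number of elements of a conjugacy class, as a complex number. -/
def classCard (c : ConjClasses G) : ℂ := classVec c ⬝ᵥ classVec c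

lemma classVec_dotProduct_of_ne {c d : ConjClasses G} (h : c ≠ d) :
    classVec c ⬝ᵥ classVec d = 0 := by
  simp [dotProduct, classVec_mul_classVec, h]

lemma classCard_eq_sum (c : ConjClasses G) : classCard c = ∑ x, classVec c x := by
  simp [classCard, dotProduct, classVec_mul_classVec]

lemma classCard_ne_zero (c : ConjClasses G) : classCard c ≠ 0 := by
  classical
  obtain ⟨x, hx⟩ := exists_classVec_eq_one c
  rw [classCard_eq_sum]
  simp only [classVec, Finset.sum_boole]
  rw [Nat.cast_ne_zero]
  refine Finset.card_ne_zero_of_mem (a := x) ?_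
  by_contra h
  simp only [Finset.mem_filter, Finset.mem_univ, true_and] at h
  exact zero_ne_one ((classVec_of_not_mem h).symm.trans hx)

end Card

variable [Fintype G] [DecidableEq G]

/-- The adjacency matrices sum to the all-ones matrix, which the dual idempotents cut down to a
rectangle. -/
lemma vecMulVec_classVec_mem (c d : ConjClasses G) :
    vecMulVec (classVec c) (classVec d) ∈ terwilligerAlgebra G := by
  have := Fintype.ofFinite (ConjClasses G)
  have h : vecMulVec (classVec c) (classVec d) =
      dualIdempotentMatrix c * (∑ b, adjMatrix b) * dualIdempotentMatrix d := by
    ext x y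
    rw [dualIdempotentMatrix_eq, dualIdempotentMatrix_eq, mul_diagonal, diagonal_mul,
      Matrix.sum_apply]
    simp [adjMatrix_apply, sum_classVec, vecMulVec_apply]
  rw [h]
  exact mul_mem (mul_mem (dualIdempotent c).2 (sum_mem fun b _ => (adj b).2)) (dualIdempotent d).2

/-- The all-ones block on the rectangle of two classes, as an element of `T(G)`. -/
def block (c d : ConjClasses G) : terwilligerAlgebra G :=
  ⟨vecMulVec (classVec c) (classVec d), vecMulVec_classVec_mem c d⟩

lemma block_mul_mul_block (c d e f : ConjClasses G) (x : terwilligerAlgebra G) :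
    block c d * x * block e f = (classVec d ⬝ᵥ (x.1 *ᵥ classVec e)) • block c f := by
  apply Subtype.ext
  change vecMulVec _ _ * x.1 * vecMulVec _ _ = _ • vecMulVec _ _
  rw [mul_assoc, mul_vecMulVec, vecMulVec_mul_vecMulVec, vecMulVec_smul]

lemma block_mul_block (c d f : ConjClasses G) :
    block c d * block d f = classCard d • block c f := by
  have h := block_mul_mul_block c d d f 1
  rwa [mul_one, show ((1 : terwilligerAlgebra G) : Matrix G G ℂ) = 1 from rfl, one_mulVec] at h

lemma block_mul_block_of_ne {d e : ConjClasses G} (h : d ≠ e) (c f : ConjClasses G) :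
    block c d * block e f = 0 := by
  have h1 := block_mul_mul_block c d e f 1
  rwa [mul_one, show ((1 : terwilligerAlgebra G) : Matrix G G ℂ) = 1 from rfl, one_mulVec,
    classVec_dotProduct_of_ne h, zero_smul] at h1

/-- Such a class is a single central point, so its block is one diagonal entry. -/
lemma block_self_of_not_isOutside (hZ : Subgroup.center G = commutator G)
    {c : ConjClasses G} (hc : ¬ IsOutside c) :
    (classCard c)⁻¹ • block c c = dualIdempotent c := by
  obtain ⟨z, hz, rfl⟩ := exists_eq_mk_of_not_isOutside hZ hc
  have h1 : classVec (ConjClasses.mk z) = Pi.single z 1 := by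
    classical
    ext x
    rw [Pi.single_apply]
    exact if_congr (mem_carrier_mk_of_mem_center hz) rfl rfl
  have h2 : classCard (ConjClasses.mk z) = 1 := by simp [classCard, h1]
  rw [h2, inv_one, one_smul]
  apply Subtype.ext
  change vecMulVec _ _ = dualIdempotentMatrix _
  rw [dualIdempotentMatrix_eq, h1]
  ext x y
  simp only [vecMulVec_apply, diagonal_apply, Pi.single_apply]
  split_ifs <;> simp_all

lemma block_smul_single (c : ConjClasses G) :
    block c 1 • (Pi.single (1 : G) (1 : ℂ) : G → ℂ) = classVec c := by
  change vecMulVec (classVec c) (classVec 1) *ᵥ _ = _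
  ext x
  simp [vecMulVec_apply, classVec_one]

lemma vecMulVec_mem_of_mem_primaryModule {v : G → ℂ} (hv : v ∈ primaryModule G)
    (d : ConjClasses G) : vecMulVec v (classVec d) ∈ terwilligerAlgebra G := by
  obtain ⟨t, rfl⟩ := Submodule.mem_span_singleton.mp hv
  rw [single_eq_classVec]
  change vecMulVec (t.1 *ᵥ _) _ ∈ _
  rw [← mul_vecMulVec]
  exact (t * block 1 d).2

/-- The embedding of the primary module in `T(G)` through the columns indexed by a class. -/
def primaryEmbedding (d : ConjClasses G) : primaryModule G →ₗ[terwilligerAlgebra G]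
    terwilligerAlgebra G where
  toFun v := ⟨vecMulVec v.1 (classVec d), vecMulVec_mem_of_mem_primaryModule v.2 d⟩
  map_add' _ _ := Subtype.ext (add_vecMulVec _ _ _)
  map_smul' _ _ := Subtype.ext (mul_vecMulVec _ _ _).symm

lemma primaryEmbedding_injective (d : ConjClasses G) :
    Function.Injective (primaryEmbedding d) := by
  intro v w h
  obtain ⟨y, hy⟩ := exists_classVec_eq_one d
  apply Subtype.ext
  ext x
  have h1 := congrFun (congrFun (congrArg Subtype.val h) x) y
  change vecMulVec v.1 (classVec d) x y = vecMulVec w.1 (classVec d) x y at h1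
  simpa [vecMulVec_apply, hy] using h1

lemma block_mem_primaryComponent (c d : ConjClasses G) : block c d ∈ primaryComponent G := by
  have h1 : LinearMap.range (primaryEmbedding d) ≤ primaryComponent G :=
    le_sSup ⟨(LinearEquiv.ofInjective _ (primaryEmbedding_injective d)).symm⟩
  exact h1 ⟨⟨classVec c, Submodule.mem_span_singleton.mpr ⟨block c 1, block_smul_single c⟩⟩, rfl⟩

/-- The identity of the primary component. -/
def primaryIdempotent [Fintype (ConjClasses G)] : terwilligerAlgebra G :=
  ∑ c : ConjClasses G, (classCard c)⁻¹ • block c c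

/-! ### The primary idempotent and simplicity of its ideal. -/

section Primary

variable [Fintype (ConjClasses G)]

lemma primaryIdempotent_mul_block (c d : ConjClasses G) :
    primaryIdempotent * block c d = block c d := by
  rw [primaryIdempotent, Finset.sum_mul, Finset.sum_eq_single c]
  · rw [smul_mul_assoc, block_mul_block, inv_smul_smul₀ (classCard_ne_zero c)]
  · intro b _ hb
    rw [smul_mul_assoc, block_mul_block_of_ne hb, smul_zero]
  · simp

lemma primaryIdempotent_mul_mul (x : terwilligerAlgebra G) :
    ∃ m : ConjClasses G → ConjClasses G → ℂ,
      primaryIdempotent * x * primaryIdempotent = ∑ c, ∑ d, m c d • block c d := by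
  refine ⟨fun c d => (classCard c)⁻¹ * ((classCard d)⁻¹ * (classVec c ⬝ᵥ (x.1 *ᵥ classVec d))), ?_⟩
  simp only [primaryIdempotent, Finset.sum_mul, Finset.mul_sum, smul_mul_assoc, mul_smul_comm,
    block_mul_mul_block, Finset.smul_sum, smul_smul]
  conv_rhs => rw [Finset.sum_comm]
  refine Finset.sum_congr rfl fun c _ => Finset.sum_congr rfl fun d _ => ?_
  congr 1
  ring

lemma primaryIdempotent_smul_of_mem (hcomm : ∀ x : terwilligerAlgebra G,
    x * primaryIdempotent = primaryIdempotent * x) {v : G → ℂ} (hv : v ∈ primaryModule G) :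
    (primaryIdempotent : terwilligerAlgebra G) • v = v := by
  obtain ⟨t, rfl⟩ := Submodule.mem_span_singleton.mp hv
  rw [smul_smul, ← hcomm, ← smul_smul]
  congr 1
  have h1 : block (1 : ConjClasses G) 1 • (Pi.single (1 : G) (1 : ℂ) : G → ℂ) = Pi.single 1 1 := by
    rw [block_smul_single, single_eq_classVec]
  conv_lhs => rw [← h1]
  rw [smul_smul, primaryIdempotent_mul_block, h1]

/-- A left ideal isomorphic to the primary module is fixed by the primary idempotent, since the
primary module is; centrality moves the idempotent to the right. Conversely, an element fixed by it
is a combination of blocks, each lying in an embedded copy of the primary module. -/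
lemma mem_primaryComponent_iff (hidem : IsIdempotentElem (primaryIdempotent : terwilligerAlgebra G))
    (hcomm : ∀ x : terwilligerAlgebra G, x * primaryIdempotent = primaryIdempotent * x)
    (x : terwilligerAlgebra G) : x ∈ primaryComponent G ↔ x * primaryIdempotent = x := by
  constructor
  · intro hx
    let K : Ideal (terwilligerAlgebra G) :=
      { carrier := {y | y * primaryIdempotent = y}
        add_mem' := fun ha hb => by
          rw [Set.mem_ofPred_eq] at ha hb ⊢
          rw [add_mul, ha, hb]
        zero_mem' := zero_mul _
        smul_mem' := fun r a ha => by
          rw [Set.mem_ofPred_eq] at ha ⊢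
          rw [smul_eq_mul, mul_assoc, ha] }
    have hK : primaryComponent G ≤ K := by
      refine sSup_le ?_
      rintro m ⟨f⟩ y hy
      change y * primaryIdempotent = y
      have h1 : f ⟨primaryIdempotent * y, m.smul_mem primaryIdempotent hy⟩ = f ⟨y, hy⟩ :=
        (f.map_smulₛₗ primaryIdempotent ⟨y, hy⟩).trans
          (Subtype.ext (primaryIdempotent_smul_of_mem hcomm (f ⟨y, hy⟩).2))
      rw [hcomm]
      exact congrArg Subtype.val (f.injective h1)
    exact hK hx
  · intro hx
    obtain ⟨m, hm⟩ := primaryIdempotent_mul_mul x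
    rw [← hcomm, mul_assoc, hidem, hx] at hm
    rw [hm]
    exact sum_mem fun c _ => sum_mem fun d _ =>
      Submodule.smul_of_tower_mem _ _ (block_mem_primaryComponent c d)

lemma primaryComponent_minimal
    (hidem : IsIdempotentElem (primaryIdempotent : terwilligerAlgebra G))
    (hcomm : ∀ x : terwilligerAlgebra G, x * primaryIdempotent = primaryIdempotent * x) :
    Minimal (fun J : Ideal (terwilligerAlgebra G) => J.IsTwoSided ∧ J ≠ ⊥)
      (primaryComponent G) := by
  have hmem := mem_primaryComponent_iff hidem hcomm
  have hne : ∀ c d : ConjClasses G, block c d ≠ 0 := by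
    intro c d h
    obtain ⟨x, hx⟩ := exists_classVec_eq_one c
    obtain ⟨y, hy⟩ := exists_classVec_eq_one d
    have h1 := congrFun (congrFun (congrArg Subtype.val h) x) y
    change vecMulVec (classVec c) (classVec d) x y = 0 at h1
    simp [vecMulVec_apply, hx, hy] at h1
  refine ⟨⟨⟨fun {a} b ha => ?_⟩, fun h => ?_⟩, ?_⟩
  · rw [hmem] at ha ⊢
    rw [mul_assoc, hcomm, ← mul_assoc, ha]
  · exact hne 1 1 ((Submodule.eq_bot_iff _).mp h _ (block_mem_primaryComponent 1 1))
  · rintro J ⟨hJ2, hJ⟩ hJV x hx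
    obtain ⟨y, hyJ, hy0⟩ := Submodule.exists_mem_ne_zero_of_ne_bot hJ
    have expand : ∀ x ∈ primaryComponent G, ∃ m : ConjClasses G → ConjClasses G → ℂ,
        x = ∑ c, ∑ d, m c d • block c d := fun x hx => by
      obtain ⟨m, hm⟩ := primaryIdempotent_mul_mul x
      rw [hmem] at hx
      rw [← hcomm, mul_assoc, hidem, hx] at hm
      exact ⟨m, hm⟩
    obtain ⟨m, hm⟩ := expand y (hJV hyJ)
    obtain ⟨a, b, hab⟩ : ∃ a b, m a b ≠ 0 := by
      by_contra! h
      exact hy0 (by simp [hm, h])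
    have hall : ∀ c d, block c d ∈ J := by
      intro c d
      -- Matrix-unit argument: the sandwich isolates the nonzero coefficient `m a b` and moves it to
      -- position `(c, d)`.
      have h1 : block c a * y * block b d ∈ J :=
        J.mul_mem_right _ (J.mul_mem_left _ hyJ)
      have h2 : block c a * y * block b d =
          (m a b * (classCard a * classCard b)) • block c d := by
        rw [hm, Finset.mul_sum, Finset.sum_mul, Finset.sum_eq_single a, Finset.mul_sum,
          Finset.sum_mul, Finset.sum_eq_single b]
        · rw [mul_smul_comm, smul_mul_assoc, block_mul_block, smul_mul_assoc, block_mul_block,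
            smul_smul, smul_smul, mul_assoc]
        · intro e _ he
          rw [mul_smul_comm, block_mul_block, smul_mul_assoc, smul_mul_assoc,
            block_mul_block_of_ne he, smul_zero, smul_zero]
        · simp
        · intro e _ he
          simp [Finset.mul_sum, block_mul_block_of_ne he.symm]
        · simp
      rw [h2] at h1
      have h3 := Submodule.smul_of_tower_mem J (m a b * (classCard a * classCard b))⁻¹ h1
      rwa [inv_smul_smul₀ (mul_ne_zero hab
        (mul_ne_zero (classCard_ne_zero a) (classCard_ne_zero b)))] at h3
    obtain ⟨l, rfl⟩ := expand x hx
    exact sum_mem fun c _ => sum_mem fun d _ => Submodule.smul_of_tower_mem _ _ (hall c d)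

end Primary

end Blocks

/-! ### Idempotents attached to characters of the centre. -/

section CentralCharacters

variable {G : Type*} [Group G] [Fintype G] [DecidableEq G]

lemma adjMatrix_mk_mul_apply {z : G} (hz : z ∈ Subgroup.center G) (M : Matrix G G ℂ) (x y : G) :
    (adjMatrix (ConjClasses.mk z) * M) x y = M (z * x) y := by
  simp [Matrix.mul_apply, adjMatrix_mk_apply hz]

lemma mul_adjMatrix_mk_apply {z : G} (hz : z ∈ Subgroup.center G) (M : Matrix G G ℂ) (x y : G) :
    (M * adjMatrix (ConjClasses.mk z)) x y = M x (z⁻¹ * y) := by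
  simp [Matrix.mul_apply, adjMatrix_mk_apply hz, ← inv_mul_eq_iff_eq_mul]

lemma adj_one : adj (ConjClasses.mk (1 : G)) = 1 := by
  apply Subtype.ext
  ext x y
  refine (adjMatrix_mk_apply (one_mem _) x y).trans ?_
  simp [Matrix.one_apply, eq_comm]

lemma adj_mk_mul_adj_mk {z w : G} (hz : z ∈ Subgroup.center G) (hw : w ∈ Subgroup.center G) :
    adj (ConjClasses.mk z) * adj (ConjClasses.mk w) = adj (ConjClasses.mk (z * w)) := by
  apply Subtype.ext
  ext x y
  refine (adjMatrix_mk_mul_apply hz _ x y).trans ?_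
  refine (adjMatrix_mk_apply hw _ _).trans ((adjMatrix_mk_apply (mul_mem hz hw) x y).trans ?_).symm
  rw [← mul_assoc, Subgroup.mem_center_iff.mp hz w]

open Classical in
lemma dualIdempotent_mul_dualIdempotent (c d : ConjClasses G) :
    dualIdempotent c * dualIdempotent d = if c = d then dualIdempotent c else 0 := by
  apply Subtype.ext
  change dualIdempotentMatrix c * dualIdempotentMatrix d = _
  rw [dualIdempotentMatrix_eq, dualIdempotentMatrix_eq, diagonal_mul_diagonal]
  simp only [classVec_mul_classVec]
  split_ifs
  · exact (dualIdempotentMatrix_eq c).symm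
  · exact diagonal_zero

lemma sum_dualIdempotent [Fintype (ConjClasses G)] :
    ∑ c : ConjClasses G, dualIdempotent c = 1 := by
  apply Subtype.ext
  rw [AddSubmonoidClass.coe_finsetSum]
  change ∑ c : ConjClasses G, dualIdempotentMatrix c = 1
  ext x y
  rw [Matrix.sum_apply]
  by_cases h : x = y
  · subst h
    simp [dualIdempotentMatrix_eq, sum_classVec]
  · simp [dualIdempotentMatrix_eq, h]

variable (hG : IsCamina G) (hZ : Subgroup.center G = commutator G)

include hG hZ

lemma IsCamina.adj_mk_mul_dualIdempotent {c : ConjClasses G} (hc : IsOutside c) {z : G}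
    (hz : z ∈ Subgroup.center G) :
    adj (ConjClasses.mk z) * dualIdempotent c = dualIdempotent c * adj (ConjClasses.mk z) := by
  apply Subtype.ext
  ext x y
  refine (adjMatrix_mk_mul_apply hz _ x y).trans ((mul_adjMatrix_mk_apply hz _ x y).trans ?_).symm
  change dualIdempotentMatrix c _ _ = dualIdempotentMatrix c _ _
  rw [dualIdempotentMatrix_eq, diagonal_apply, diagonal_apply,
    hG.classVec_mul hZ hc hz]
  exact if_congr eq_inv_mul_iff_mul_eq rfl rfl

lemma IsCamina.adj_mk_mul_adj {d : ConjClasses G} (hd : IsOutside d) {z : G}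
    (hz : z ∈ Subgroup.center G) : adj (ConjClasses.mk z) * adj d = adj d := by
  apply Subtype.ext
  ext x y
  refine (adjMatrix_mk_mul_apply hz _ x y).trans ?_
  change adjMatrix d _ _ = adjMatrix d _ _
  rw [adjMatrix_apply, adjMatrix_apply, _root_.mul_inv_rev, ← mul_assoc,
    Subgroup.mem_center_iff.mp (inv_mem hz), hG.classVec_mul hZ hd (inv_mem hz)]

lemma IsCamina.adj_mul_adj_mk {d : ConjClasses G} (hd : IsOutside d) {z : G}
    (hz : z ∈ Subgroup.center G) : adj d * adj (ConjClasses.mk z) = adj d := by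
  apply Subtype.ext
  ext x y
  refine (mul_adjMatrix_mk_apply hz _ x y).trans ?_
  change adjMatrix d _ _ = adjMatrix d _ _
  rw [adjMatrix_apply, adjMatrix_apply, mul_assoc, hG.classVec_mul hZ hd (inv_mem hz)]

omit hG hZ

variable [Fintype (Subgroup.center G)]

/-- The component of the dual idempotent of a class at a character of the centre. -/
def charIdempotent (χ : Subgroup.center G →* ℂˣ) (c : ConjClasses G) : terwilligerAlgebra G :=
  (Fintype.card (Subgroup.center G) : ℂ)⁻¹ •
    ∑ z : Subgroup.center G, (χ z : ℂ) • (dualIdempotent c * adj (ConjClasses.mk (z : G)))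

open Classical in
lemma dualIdempotent_mul_charIdempotent (χ : Subgroup.center G →* ℂˣ) (c d : ConjClasses G) :
    dualIdempotent d * charIdempotent χ c = if d = c then charIdempotent χ c else 0 := by
  simp only [charIdempotent, mul_smul_comm, Finset.mul_sum, ← mul_assoc,
    dualIdempotent_mul_dualIdempotent]
  split_ifs with h
  · rw [h]
  · simp

/-- Right multiplication by `A_w` translates the summation variable by `w`. -/
lemma charIdempotent_mul_adj_mk (χ : Subgroup.center G →* ℂˣ) (c : ConjClasses G)
    (w : Subgroup.center G) : charIdempotent χ c * adj (ConjClasses.mk (w : G)) =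
      ((χ w)⁻¹ : ℂˣ).val • charIdempotent χ c := by
  simp only [charIdempotent, smul_mul_assoc, Finset.sum_mul, mul_assoc,
    adj_mk_mul_adj_mk (Subtype.prop _) (Subtype.prop _)]
  rw [smul_comm]
  congr 1
  rw [Finset.smul_sum]
  refine Fintype.sum_equiv (Equiv.mulRight w) _ _ fun z => ?_
  rw [smul_smul, Equiv.coe_mulRight, map_mul, ← Units.val_mul, mul_comm (χ z), inv_mul_cancel_left]
  rfl

lemma sum_character_eq_zero {A : Type*} [Group A] [Fintype A] {χ : A →* ℂˣ} (h : χ ≠ 1) :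
    ∑ z, (χ z : ℂ) = 0 := by
  refine sum_hom_units_eq_zero ((Units.coeHom ℂ).comp χ) fun h1 => h ?_
  ext z
  exact DFunLike.congr_fun h1 z

/-- Only `z = 1` contributes to a diagonal entry at a point of `c`, which is therefore `|Z|⁻¹`. -/
lemma charIdempotent_ne_zero (χ : Subgroup.center G →* ℂˣ) (c : ConjClasses G) :
    charIdempotent χ c ≠ 0 := by
  intro h
  obtain ⟨x, hx⟩ := exists_classVec_eq_one c
  have hz : ∀ z : Subgroup.center G, x = z * x ↔ z = 1 := fun z => by
    rw [eq_comm, mul_eq_right, OneMemClass.coe_eq_one]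
  have h1 := congrFun (congrFun (congrArg Subtype.val h) x) x
  have h2 : (charIdempotent χ c).1 x x = (Fintype.card (Subgroup.center G) : ℂ)⁻¹ := by
    rw [charIdempotent]
    change ((Fintype.card (Subgroup.center G) : ℂ)⁻¹ • (terwilligerAlgebra G).subtype
      (∑ z : Subgroup.center G, (χ z : ℂ) • (dualIdempotent c * adj (ConjClasses.mk (z : G))))) x x = _
    rw [map_sum, Matrix.smul_apply, Matrix.sum_apply]
    change _ • ∑ z : Subgroup.center G, (χ z : ℂ) •
      (dualIdempotentMatrix c * adjMatrix (ConjClasses.mk (z : G))) x x = _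
    simp only [dualIdempotentMatrix_eq, diagonal_mul, hx, one_mul,
      adjMatrix_mk_apply (Subtype.prop _), hz]
    simp
  rw [h2] at h1
  change _ = (0 : ℂ) at h1
  simp [Fintype.card_ne_zero] at h1

include hG hZ

lemma IsCamina.charIdempotent_mul_dualIdempotent_self (χ : Subgroup.center G →* ℂˣ)
    {c : ConjClasses G} (hc : IsOutside c) :
    charIdempotent χ c * dualIdempotent c = charIdempotent χ c := by
  simp only [charIdempotent, smul_mul_assoc, Finset.sum_mul, mul_assoc,
    hG.adj_mk_mul_dualIdempotent hZ hc (Subtype.prop _)]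
  simp only [← mul_assoc, dualIdempotent_mul_dualIdempotent, if_true]

open Classical in
lemma IsCamina.charIdempotent_mul_dualIdempotent (χ : Subgroup.center G →* ℂˣ)
    {c : ConjClasses G} (hc : IsOutside c) (d : ConjClasses G) :
    charIdempotent χ c * dualIdempotent d = if d = c then charIdempotent χ c else 0 := by
  rw [← hG.charIdempotent_mul_dualIdempotent_self hZ χ hc, mul_assoc,
    dualIdempotent_mul_dualIdempotent]
  simp only [eq_comm (a := c)]
  split_ifs
  · rfl
  · exact mul_zero _

lemma IsCamina.adj_mk_mul_charIdempotent (χ : Subgroup.center G →* ℂˣ)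
    {c : ConjClasses G} (hc : IsOutside c) (w : Subgroup.center G) :
    adj (ConjClasses.mk (w : G)) * charIdempotent χ c =
      ((χ w)⁻¹ : ℂˣ).val • charIdempotent χ c := by
  rw [← charIdempotent_mul_adj_mk]
  simp only [charIdempotent, smul_mul_assoc, mul_smul_comm, Finset.sum_mul, Finset.mul_sum]
  congr 1
  refine Finset.sum_congr rfl fun z _ => ?_
  rw [← mul_assoc, hG.adj_mk_mul_dualIdempotent hZ hc w.2, mul_assoc, mul_assoc,
    adj_mk_mul_adj_mk w.2 z.2, adj_mk_mul_adj_mk z.2 w.2, Subgroup.mem_center_iff.mp w.2]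

lemma IsCamina.adj_mul_charIdempotent {χ : Subgroup.center G →* ℂˣ} (hχ : χ ≠ 1)
    {c d : ConjClasses G} (hc : IsOutside c) (hd : IsOutside d) :
    adj d * charIdempotent χ c = 0 := by
  simp only [charIdempotent, mul_smul_comm, Finset.mul_sum,
    ← hG.adj_mk_mul_dualIdempotent hZ hc (Subtype.prop _)]
  simp only [← mul_assoc, hG.adj_mul_adj_mk hZ hd (Subtype.prop _)]
  rw [← Finset.sum_smul, sum_character_eq_zero hχ, zero_smul, smul_zero]

lemma IsCamina.charIdempotent_mul_adj {χ : Subgroup.center G →* ℂˣ} (hχ : χ ≠ 1)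
    {c d : ConjClasses G} (hd : IsOutside d) :
    charIdempotent χ c * adj d = 0 := by
  simp only [charIdempotent, smul_mul_assoc, Finset.sum_mul, mul_assoc,
    hG.adj_mk_mul_adj hZ hd (Subtype.prop _)]
  rw [← Finset.sum_smul, sum_character_eq_zero hχ, zero_smul, smul_zero]

-- The left factor acts on the right one by the average of `χ * ψ⁻¹` over the centre, so this is
-- orthogonality of characters.
open Classical in
lemma IsCamina.charIdempotent_mul_charIdempotent_same (χ ψ : Subgroup.center G →* ℂˣ)
    {c : ConjClasses G} (hc : IsOutside c) :
    charIdempotent χ c * charIdempotent ψ c = if χ = ψ then charIdempotent ψ c else 0 := by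
  have h1 : charIdempotent χ c * charIdempotent ψ c =
      ((Fintype.card (Subgroup.center G) : ℂ)⁻¹ *
        ∑ z, (((χ * ψ⁻¹) z : ℂˣ) : ℂ)) • charIdempotent ψ c := by
    conv_lhs => rw [charIdempotent]
    simp only [smul_mul_assoc, Finset.sum_mul, mul_assoc,
      hG.adj_mk_mul_charIdempotent hZ ψ hc, mul_smul_comm, dualIdempotent_mul_charIdempotent,
      if_true]
    simp only [smul_smul, ← Finset.sum_smul, MonoidHom.mul_apply, MonoidHom.inv_apply,
      Units.val_mul]
  rw [h1]
  split_ifs with h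
  · subst h
    simp
  · rw [sum_character_eq_zero fun h2 => h (mul_inv_eq_one.mp h2), mul_zero, zero_smul]

open Classical in
lemma IsCamina.charIdempotent_mul_charIdempotent (χ ψ : Subgroup.center G →* ℂˣ)
    {c d : ConjClasses G} (hc : IsOutside c) (hd : IsOutside d) :
    charIdempotent χ c * charIdempotent ψ d =
      if c = d ∧ χ = ψ then charIdempotent ψ d else 0 := by
  by_cases h : c = d
  · subst h
    rw [hG.charIdempotent_mul_charIdempotent_same hZ χ ψ hc]
    simp
  · rw [← hG.charIdempotent_mul_dualIdempotent_self hZ χ hc, mul_assoc,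
      dualIdempotent_mul_charIdempotent]
    simp [h]

/-- The centre acts simply transitively on `c` by translation: each pair of points of `c` is joined
by exactly one `A_z`. -/
lemma IsCamina.charIdempotent_one {c : ConjClasses G} (hc : IsOutside c) :
    charIdempotent 1 c = (classCard c)⁻¹ • block c c := by
  obtain ⟨g, hg⟩ : ∃ g, g ∈ c.carrier := by
    induction c using Quotient.inductionOn with
    | _ g => exact ⟨g, ConjClasses.mem_carrier_mk⟩
  have hcard : classCard c = Fintype.card (Subgroup.center G) := by
    rw [classCard_eq_sum]
    simp only [classVec, hG.mem_carrier_iff hZ hc hg]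
    classical
    rw [Fintype.card, ← Equiv.sum_comp (Equiv.mulRight g)]
    simp [Fintype.card_subtype]
  rw [charIdempotent, hcard]
  congr 1
  apply Subtype.ext
  change (terwilligerAlgebra G).subtype _ = vecMulVec _ _
  rw [map_sum]
  ext x y
  rw [Matrix.sum_apply, vecMulVec_apply]
  change ∑ z : Subgroup.center G, (1 : ℂ) •
      (dualIdempotentMatrix c * adjMatrix (ConjClasses.mk (z : G))) x y = _
  simp only [dualIdempotentMatrix_eq, diagonal_mul, one_smul, adjMatrix_mk_apply (Subtype.prop _)]
  rw [← Finset.mul_sum]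
  by_cases hx : x ∈ c.carrier
  · congr 1
    by_cases hy : y ∈ c.carrier
    · have hyx := (hG.mem_carrier_iff hZ hc hx).mp hy
      rw [classVec_of_mem hy, Fintype.sum_eq_single ⟨y * x⁻¹, hyx⟩]
      · simp
      · intro z hz
        refine if_neg fun h => hz (Subtype.ext ?_)
        simp [h]
    · rw [classVec_of_not_mem hy]
      refine Finset.sum_eq_zero fun z _ => if_neg ?_
      rintro rfl
      exact hy ((hG.mem_carrier_mul_iff hZ hc z.2 x).mpr hx)
  · simp [classVec_of_not_mem hx]

omit hG hZ in
lemma sum_charIdempotent {ι : Type*} [Fintype ι] {χ : ι → Subgroup.center G →* ℂˣ}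
    (hχ : ∀ z : Subgroup.center G,
      ∑ α, (χ α z : ℂ) = if z = 1 then (Fintype.card (Subgroup.center G) : ℂ) else 0)
    (c : ConjClasses G) : ∑ α, charIdempotent (χ α) c = dualIdempotent c := by
  simp only [charIdempotent]
  rw [← Finset.smul_sum, Finset.sum_comm]
  simp only [← Finset.sum_smul, hχ, ite_smul, zero_smul, Finset.sum_ite_eq', Finset.mem_univ,
    if_true]
  rw [inv_smul_smul₀ (Nat.cast_ne_zero.mpr Fintype.card_ne_zero), OneMemClass.coe_one, adj_one,
    mul_one]

lemma IsCamina.mul_charIdempotent {χ : Subgroup.center G →* ℂˣ} (hχ : χ ≠ 1)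
    {c : ConjClasses G} (hc : IsOutside c) (x : terwilligerAlgebra G) :
    ∃ r : ℂ, x * charIdempotent χ c = r • charIdempotent χ c := by
  obtain ⟨x, hx⟩ := x
  induction hx using Algebra.adjoin_induction with
  | mem x hx =>
    rcases hx with ⟨d, rfl⟩ | ⟨d, rfl⟩
    · change ∃ r : ℂ, adj d * _ = _
      by_cases hd : IsOutside d
      · exact ⟨0, by rw [hG.adj_mul_charIdempotent hZ hχ hc hd, zero_smul]⟩
      · obtain ⟨z, hz, rfl⟩ := exists_eq_mk_of_not_isOutside hZ hd
        exact ⟨_, hG.adj_mk_mul_charIdempotent hZ χ hc ⟨z, hz⟩⟩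
    · change ∃ r : ℂ, dualIdempotent d * _ = _
      rw [dualIdempotent_mul_charIdempotent]
      split_ifs
      · exact ⟨1, (one_smul _ _).symm⟩
      · exact ⟨0, (zero_smul _ _).symm⟩
  | algebraMap r => exact ⟨r, (Algebra.smul_def r (charIdempotent χ c)).symm⟩
  | add x y hx hy h1 h2 =>
    obtain ⟨r, hr⟩ := h1
    obtain ⟨s, hs⟩ := h2
    refine ⟨r + s, ?_⟩
    rw [add_smul, ← hr, ← hs]
    exact add_mul (⟨x, hx⟩ : terwilligerAlgebra G) ⟨y, hy⟩ _
  | mul x y hx hy h1 h2 =>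
    obtain ⟨r, hr⟩ := h1
    obtain ⟨s, hs⟩ := h2
    refine ⟨s * r, ?_⟩
    rw [mul_smul, ← hr, ← mul_smul_comm, ← hs]
    exact mul_assoc (⟨x, hx⟩ : terwilligerAlgebra G) ⟨y, hy⟩ _

lemma IsCamina.charIdempotent_mul {χ : Subgroup.center G →* ℂˣ} (hχ : χ ≠ 1)
    {c : ConjClasses G} (hc : IsOutside c) (x : terwilligerAlgebra G) :
    ∃ r : ℂ, charIdempotent χ c * x = r • charIdempotent χ c := by
  obtain ⟨x, hx⟩ := x
  induction hx using Algebra.adjoin_induction with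
  | mem x hx =>
    rcases hx with ⟨d, rfl⟩ | ⟨d, rfl⟩
    · change ∃ r : ℂ, _ * adj d = _
      by_cases hd : IsOutside d
      · exact ⟨0, by rw [hG.charIdempotent_mul_adj hZ hχ hd, zero_smul]⟩
      · obtain ⟨z, hz, rfl⟩ := exists_eq_mk_of_not_isOutside hZ hd
        exact ⟨_, charIdempotent_mul_adj_mk χ c ⟨z, hz⟩⟩
    · change ∃ r : ℂ, _ * dualIdempotent d = _
      rw [hG.charIdempotent_mul_dualIdempotent hZ χ hc]
      split_ifs
      · exact ⟨1, (one_smul _ _).symm⟩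
      · exact ⟨0, (zero_smul _ _).symm⟩
  | algebraMap r =>
    exact ⟨r, ((Algebra.smul_def r (charIdempotent χ c)).trans (Algebra.commutes r _)).symm⟩
  | add x y hx hy h1 h2 =>
    obtain ⟨r, hr⟩ := h1
    obtain ⟨s, hs⟩ := h2
    refine ⟨r + s, ?_⟩
    rw [add_smul, ← hr, ← hs]
    exact mul_add _ (⟨x, hx⟩ : terwilligerAlgebra G) ⟨y, hy⟩
  | mul x y hx hy h1 h2 =>
    obtain ⟨r, hr⟩ := h1
    obtain ⟨s, hs⟩ := h2
    refine ⟨r * s, ?_⟩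
    rw [mul_smul, ← hs, ← smul_mul_assoc, ← hr]
    exact (mul_assoc _ (⟨x, hx⟩ : terwilligerAlgebra G) ⟨y, hy⟩).symm

/-- With `e` the idempotent, the left and right scalars of `x` agree because both can be read off
from `e * x * e`. -/
lemma IsCamina.charIdempotent_comm {χ : Subgroup.center G →* ℂˣ} (hχ : χ ≠ 1)
    {c : ConjClasses G} (hc : IsOutside c) (x : terwilligerAlgebra G) :
    x * charIdempotent χ c = charIdempotent χ c * x := by
  obtain ⟨r, hr⟩ := hG.mul_charIdempotent hZ hχ hc x
  obtain ⟨s, hs⟩ := hG.charIdempotent_mul hZ hχ hc x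
  have hid := hG.charIdempotent_mul_charIdempotent_same hZ χ χ hc
  rw [if_pos rfl] at hid
  have h1 : (charIdempotent χ c * x) * charIdempotent χ c =
      charIdempotent χ c * (x * charIdempotent χ c) := mul_assoc _ _ _
  rw [hr, hs, smul_mul_assoc, mul_smul_comm, hid] at h1
  rw [hr, hs, h1]

end CentralCharacters

open Classical in
/-- Left ideals cut out by complete orthogonal idempotents form an internal direct sum. -/
lemma isInternal_of_completeOrthogonalIdempotents {R ι : Type*} [Ring R] [Fintype ι] {e : ι → R}
    (he : CompleteOrthogonalIdempotents e) {I : ι → Ideal R}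
    (hI : ∀ i x, x ∈ I i ↔ x * e i = x) : DirectSum.IsInternal I := by
  have hmem : ∀ i, e i ∈ I i := fun i => (hI i _).mpr (he.idem i)
  rw [DirectSum.isInternal_submodule_iff_iSupIndep_and_iSup_eq_top]
  constructor
  · rw [iSupIndep_def]
    intro i
    rw [Submodule.disjoint_def]
    intro x hx hx'
    -- Right multiplication by `e i` kills every other ideal but fixes `I i` pointwise.
    have hle : ⨆ j, ⨆ (_ : j ≠ i), I j ≤ LinearMap.ker (LinearMap.toSpanSingleton R R (e i)) := by
      refine iSup₂_le fun j hj y hy => ?_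
      rw [LinearMap.mem_ker, LinearMap.toSpanSingleton_apply, smul_eq_mul, ← (hI j y).mp hy,
        mul_assoc, he.ortho hj, mul_zero]
    have h0 := hle hx'
    rwa [LinearMap.mem_ker, LinearMap.toSpanSingleton_apply, smul_eq_mul, (hI i x).mp hx] at h0
  · rw [Ideal.eq_top_iff_one, ← he.complete]
    exact sum_mem fun i _ => (le_iSup I i) (hmem i)

/-! ### Identification of `W_c(α)` with a character idempotent. -/

section Decomposition

open scoped IsMulCommutative

variable {G : Type*} [Group G] [Fintype G] [DecidableEq G]
variable (hG : IsCamina G) (hZ : Subgroup.center G = commutator G)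

include hG hZ

/-- Since `A_w` commutes with `E_c^*`, corner powers are powers of `A_w` cut down to `c`; the left
factor makes this hold also for `m = 0`. -/
lemma IsCamina.dualIdempotent_mul_corner_pow {c : ConjClasses G} (hc : IsOutside c)
    (w : Subgroup.center G) (m : ℕ) :
    dualIdempotent c * (dualIdempotent c * adj (ConjClasses.mk (w : G)) * dualIdempotent c) ^ m =
      adj (ConjClasses.mk ((w ^ m : Subgroup.center G) : G)) * dualIdempotent c := by
  have hE : dualIdempotent c * dualIdempotent c = dualIdempotent c := by
    rw [dualIdempotent_mul_dualIdempotent, if_pos rfl]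
  induction m with
  | zero => rw [pow_zero, pow_zero, mul_one, OneMemClass.coe_one, adj_one, one_mul]
  | succ m ih =>
    rw [pow_succ, ← mul_assoc, ih, mul_assoc, ← mul_assoc (dualIdempotent c),
      ← mul_assoc (dualIdempotent c), hE, ← hG.adj_mk_mul_dualIdempotent hZ hc w.2,
      mul_assoc (adj (ConjClasses.mk (w : G))), hE, ← mul_assoc,
      adj_mk_mul_adj_mk (Subtype.prop _) w.2, pow_succ]
    rfl

lemma IsCamina.dualIdempotent_mul_prod_ofFn {c : ConjClasses G} (hc : IsOutside c) {m : ℕ}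
    (w : Fin m → Subgroup.center G) (s : Fin m → ℂ) (a : Fin m → ℕ) :
    dualIdempotent c * (List.ofFn fun j => s j •
      (dualIdempotent c * adj (ConjClasses.mk (w j : G)) * dualIdempotent c) ^ a j).prod =
      (∏ j, s j) • (dualIdempotent c *
        adj (ConjClasses.mk ((∏ j, w j ^ a j : Subgroup.center G) : G))) := by
  induction m with
  | zero => simp [adj_one]
  | succ m ih =>
    rw [List.ofFn_succ, List.prod_cons, ← mul_assoc, mul_smul_comm,
      hG.dualIdempotent_mul_corner_pow hZ hc, smul_mul_assoc, mul_assoc, ih, mul_smul_comm,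
      smul_smul, ← mul_assoc, hG.adj_mk_mul_dualIdempotent hZ hc (Subtype.prop _), mul_assoc,
      adj_mk_mul_adj_mk (Subtype.prop _) (Subtype.prop _), Fin.prod_univ_succ, Fin.prod_univ_succ]
    rfl

lemma IsCamina.W_eq_charIdempotent [Fintype (Subgroup.center G)] {p k : ℕ} {ζ : ℂ}
    {w : Fin k → Subgroup.center G}
    (hw : Function.Bijective (fun a : Fin k → Fin p => ∏ j, w j ^ (a j : ℕ)))
    {α : Fin k → Fin p} {χ : Subgroup.center G →* ℂˣ}
    (hχ : ∀ a : Fin k → Fin p,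
      (χ (∏ j, w j ^ (a j : ℕ)) : ℂ) = ∏ j, ζ ^ ((α j : ℕ) * (a j : ℕ)))
    {c : ConjClasses G} (hc : IsOutside c) :
    W p ζ (fun j => (w j : G)) c α = charIdempotent χ c := by
  have hcard : (Fintype.card (Subgroup.center G) : ℂ) = (p : ℂ) ^ k := by
    rw [← Fintype.card_of_bijective hw]
    simp
  rw [W, charIdempotent, hcard]
  congr 1
  refine Fintype.sum_bijective _ hw _ _ fun a => ?_
  rw [hG.dualIdempotent_mul_prod_ofFn hZ hc, hχ]

end Decomposition

/-! ### Ideals generated by an element on which the algebra acts by scalars. -/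

section OneDimensional

variable {A : Type*} [Ring A] [Algebra ℂ A] {e : A}

lemma mem_span_singleton_asIdeal_iff (hl : ∀ x, ∃ r : ℂ, x * e = r • e)
    (hr : ∀ x, ∃ r : ℂ, e * x = r • e) (x : A) :
    x ∈ TwoSidedIdeal.asIdeal (TwoSidedIdeal.span {e}) ↔ ∃ r : ℂ, x = r • e := by
  rw [TwoSidedIdeal.mem_asIdeal]
  constructor
  · intro hx
    induction hx using TwoSidedIdeal.span_induction with
    | mem x h => exact ⟨1, by rw [Set.mem_singleton_iff.mp h, one_smul]⟩
    | zero => exact ⟨0, (zero_smul _ _).symm⟩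
    | add x y _ _ h1 h2 =>
      obtain ⟨r, rfl⟩ := h1
      obtain ⟨s, rfl⟩ := h2
      exact ⟨r + s, (add_smul _ _ _).symm⟩
    | neg x _ h =>
      obtain ⟨r, rfl⟩ := h
      exact ⟨-r, (neg_smul _ _).symm⟩
    | left_absorb a x _ h =>
      obtain ⟨r, rfl⟩ := h
      obtain ⟨s, hs⟩ := hl a
      exact ⟨r * s, by rw [mul_smul_comm, hs, mul_smul]⟩
    | right_absorb a x _ h =>
      obtain ⟨r, rfl⟩ := h
      obtain ⟨s, hs⟩ := hr a
      exact ⟨r * s, by rw [smul_mul_assoc, hs, mul_smul]⟩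
  · rintro ⟨r, rfl⟩
    rw [Algebra.smul_def]
    exact TwoSidedIdeal.mul_mem_left _ _ _ (TwoSidedIdeal.subset_span rfl)

lemma minimal_span_singleton_asIdeal (he : e ≠ 0) (hl : ∀ x, ∃ r : ℂ, x * e = r • e)
    (hr : ∀ x, ∃ r : ℂ, e * x = r • e) :
    Minimal (fun J : Ideal A => J.IsTwoSided ∧ J ≠ ⊥)
      (TwoSidedIdeal.asIdeal (TwoSidedIdeal.span {e})) := by
  have hmem := mem_span_singleton_asIdeal_iff hl hr
  refine ⟨⟨⟨fun {a} b ha => ?_⟩, fun h => ?_⟩, ?_⟩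
  · obtain ⟨r, rfl⟩ := (hmem _).mp ha
    obtain ⟨s, hs⟩ := hr b
    exact (hmem _).mpr ⟨r * s, by rw [smul_mul_assoc, hs, mul_smul]⟩
  · exact he ((Submodule.eq_bot_iff _).mp h _ ((hmem e).mpr ⟨1, (one_smul _ _).symm⟩))
  · rintro J ⟨-, hJ⟩ hle x hx
    obtain ⟨y, hy, hy0⟩ := Submodule.exists_mem_ne_zero_of_ne_bot hJ
    obtain ⟨r, rfl⟩ := (hmem y).mp (hle hy)
    obtain ⟨s, rfl⟩ := (hmem x).mp hx
    have hr0 : r ≠ 0 := fun h => hy0 (by rw [h, zero_smul])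
    have := Submodule.smul_of_tower_mem J (s * r⁻¹) hy
    rwa [smul_smul, inv_mul_cancel_right₀ hr0] at this

lemma finrank_span_singleton_asIdeal (he : e ≠ 0) (hl : ∀ x, ∃ r : ℂ, x * e = r • e)
    (hr : ∀ x, ∃ r : ℂ, e * x = r • e) :
    Module.finrank ℂ (TwoSidedIdeal.asIdeal (TwoSidedIdeal.span {e})) = 1 := by
  have hmem := mem_span_singleton_asIdeal_iff hl hr
  refine finrank_eq_one ⟨e, (hmem e).mpr ⟨1, (one_smul _ _).symm⟩⟩
    (fun h => he (congrArg Subtype.val h)) fun x => ?_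
  obtain ⟨r, h⟩ := (hmem _).mp x.2
  exact ⟨r, Subtype.ext h.symm⟩

end OneDimensional

/-! ### Assembly of the central idempotents and the decomposition. -/

section Wedderburn

variable {G : Type*} [Group G] [Fintype G] [DecidableEq G] [Fintype (ConjClasses G)]
  [Fintype (Subgroup.center G)] {ι : Type*} [Fintype ι]
variable (hG : IsCamina G) (hZ : Subgroup.center G = commutator G)

/-- The central idempotents of `T(G)`: the primary one and those attached to the nontrivial
characters of the centre. -/
def wedderburnIdempotent (P : ι → Prop) (χ : ι → Subgroup.center G →* ℂˣ) :
    Option ({c : ConjClasses G // IsOutside c} × {α : ι // P α}) → terwilligerAlgebra G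
  | none => primaryIdempotent
  | some (c, α) => charIdempotent (χ α.1) c.1

include hG hZ

-- Once the primary idempotent is seen to be the complement of the orthogonal family of the
-- nontrivial characters, its own idempotency and orthogonality are automatic.
open Classical in
lemma IsCamina.completeOrthogonalIdempotents_wedderburnIdempotent {P : ι → Prop}
    [DecidablePred P] {χ : ι → Subgroup.center G →* ℂˣ} (hinj : Function.Injective χ) (hP : ∀ α, P α ↔ χ α ≠ 1)
    (hone : ∃ α, χ α = 1)
    (hχ : ∀ z : Subgroup.center G,
      ∑ α, (χ α z : ℂ) = if z = 1 then (Fintype.card (Subgroup.center G) : ℂ) else 0) :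
    CompleteOrthogonalIdempotents (wedderburnIdempotent P χ) := by
  have hmul := fun x y : {c : ConjClasses G // IsOutside c} × {α : ι // P α} =>
    hG.charIdempotent_mul_charIdempotent hZ (χ x.2.1) (χ y.2.1) x.1.2 y.1.2
  have hsome : OrthogonalIdempotents fun x : {c : ConjClasses G // IsOutside c} × {α : ι // P α} =>
      charIdempotent (χ x.2.1) x.1.1 := by
    refine ⟨fun x => ?_, fun x y hxy => ?_⟩
    · rw [IsIdempotentElem, hmul, if_pos ⟨rfl, rfl⟩]
    · refine (hmul x y).trans (if_neg ?_)
      rintro ⟨h1, h2⟩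
      exact hxy (Prod.ext (Subtype.ext h1) (Subtype.ext (hinj h2)))
  have hsum : (primaryIdempotent : terwilligerAlgebra G) =
      1 - ∑ x : {c : ConjClasses G // IsOutside c} × {α : ι // P α},
        charIdempotent (χ x.2.1) x.1.1 := by
    obtain ⟨o, ho⟩ := hone
    -- All characters together give `E_c^*`; the trivial one, at the index `o`, accounts for the
    -- block.
    have h1 : ∀ c : {c : ConjClasses G // IsOutside c},
        ∑ α : {α : ι // P α}, charIdempotent (χ α.1) c.1 =
          dualIdempotent c.1 - (classCard c.1)⁻¹ • block c.1 c.1 := by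
      intro c
      rw [← hG.charIdempotent_one hZ c.2, ← sum_charIdempotent hχ, eq_sub_iff_add_eq, ← ho,
        ← Finset.add_sum_erase _ _ (Finset.mem_univ o), add_comm]
      congr 1
      symm
      refine Finset.sum_subtype _ (fun α => ?_) (fun α => charIdempotent (χ α) c.1)
      rw [Finset.mem_erase, hP, ← ho]
      exact ⟨fun h h' => h.1 (hinj h'), fun h => ⟨fun h' => h (h' ▸ rfl), Finset.mem_univ _⟩⟩
    rw [Fintype.sum_prod_type, eq_sub_iff_add_eq, ← sum_dualIdempotent]
    simp only [h1]
    rw [← Fintype.sum_subtype_add_sum_subtype IsOutside (fun c => dualIdempotent c),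
      primaryIdempotent, ← Fintype.sum_subtype_add_sum_subtype IsOutside
        (fun c : ConjClasses G => (classCard c)⁻¹ • block c c), Finset.sum_sub_distrib]
    rw [Finset.sum_congr rfl fun (c : {c : ConjClasses G // ¬ IsOutside c}) _ =>
      block_self_of_not_isOutside hZ c.2]
    abel
  have heq : wedderburnIdempotent P χ = fun x : Option _ => x.elim
      (1 - ∑ x : {c : ConjClasses G // IsOutside c} × {α : ι // P α},
        charIdempotent (χ x.2.1) x.1.1) fun x => charIdempotent (χ x.2.1) x.1.1 := by
    funext x
    match x with
    | none => exact hsum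
    | some (c, α) => rfl
  rw [heq]
  exact CompleteOrthogonalIdempotents.option hsome

open Classical in
lemma IsCamina.primaryIdempotent_comm {P : ι → Prop} [DecidablePred P]
    {χ : ι → Subgroup.center G →* ℂˣ} (hP : ∀ α, P α ↔ χ α ≠ 1)
    (he : CompleteOrthogonalIdempotents (wedderburnIdempotent P χ)) (x : terwilligerAlgebra G) :
    x * primaryIdempotent = primaryIdempotent * x := by
  have h1 := he.complete
  rw [Fintype.sum_option] at h1
  rw [show (primaryIdempotent : terwilligerAlgebra G) = _ from
    eq_sub_of_add_eq h1, mul_sub,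
    sub_mul, mul_one, one_mul, Finset.mul_sum, Finset.sum_mul]
  congr 1
  refine Finset.sum_congr rfl fun y _ => ?_
  exact hG.charIdempotent_comm hZ ((hP _).mp y.2.2) y.1.2 x

omit hG hZ [Fintype (ConjClasses G)] [Fintype (Subgroup.center G)] [Fintype G] [Fintype ι]
  [DecidableEq G] in
lemma closure_range_coe_eq_center_iff {κ : Type*} (w : κ → Subgroup.center G) :
    Subgroup.closure (Set.range fun j => (w j : G)) = Subgroup.center G ↔
      Subgroup.closure (Set.range w) = ⊤ := by
  rw [← (Subgroup.map_injective (Subgroup.center G).subtype_injective).eq_iff,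
    MonoidHom.map_closure, ← Set.range_comp, ← MonoidHom.range_eq_map, Subgroup.range_subtype]
  rfl

omit hG hZ [Fintype (ConjClasses G)] [Fintype (Subgroup.center G)] [Fintype ι] [DecidableEq G] in
open scoped IsMulCommutative in
lemma exists_closure_range_eq_center {p k : ℕ} [Fact p.Prime]
    (hexp : ∀ x : Subgroup.center G, x ^ p = 1) (hcard : Nat.card (Subgroup.center G) = p ^ k) :
    ∃ z : Fin k → G, Subgroup.closure (Set.range z) = Subgroup.center G := by
  obtain ⟨w, hw⟩ := exists_closure_range_eq_top hexp hcard
  exact ⟨fun j => w j, (closure_range_coe_eq_center_iff w).mpr hw⟩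

omit [Fintype (ConjClasses G)] [Fintype (Subgroup.center G)] [Fintype ι] in
open scoped IsMulCommutative in
/-- The Wedderburn decomposition of the Terwilliger algebra of a Camina group whose centre is
elementary abelian and equal to the derived subgroup. -/
lemma IsCamina.isWedderburnDecomposition_components {p k : ℕ} [Fact p.Prime]
    (hexp : ∀ x : Subgroup.center G, x ^ p = 1) (hcard : Nat.card (Subgroup.center G) = p ^ k)
    {w : Fin k → Subgroup.center G} (hw : Subgroup.closure (Set.range w) = ⊤) {ζ : ℂ}
    (hζ : IsPrimitiveRoot ζ p) :
    IsWedderburnDecomposition (components p ζ fun j => (w j : G)) ∧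
      ∀ c : ConjClasses G, IsOutside c → ∀ α : Fin k → Fin p, (∃ j, (α j : ℕ) ≠ 0) →
        Module.finrank ℂ (WIdeal p ζ (fun j => (w j : G)) c α) = 1 := by
  classical
  have := Fintype.ofFinite (ConjClasses G)
  have := Fintype.ofFinite (Subgroup.center G)
  have hp : p.Prime := Fact.out
  have : NeZero p := ⟨hp.ne_zero⟩
  obtain ⟨hbij, χ, hχ⟩ := exists_characters hexp hcard hw hζ
  have hinj := characters_injective hζ hχ
  have hsum : ∀ z : Subgroup.center G,
      ∑ α, (χ α z : ℂ) = if z = 1 then (Fintype.card (Subgroup.center G) : ℂ) else 0 := by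
    intro z
    rw [characters_sum hζ hbij hχ, ← Nat.card_eq_fintype_card, hcard, Nat.cast_pow]
  have hχ0 : χ 0 = 1 := by
    ext z
    obtain ⟨a, rfl⟩ := hbij.2 z
    refine (hχ 0 a).trans ?_
    simp
  have hP : ∀ α : Fin k → Fin p, (∃ j, (α j : ℕ) ≠ 0) ↔ χ α ≠ 1 := by
    intro α
    rw [← hχ0, hinj.ne_iff, Function.ne_iff]
    exact exists_congr fun j => not_congr (Fin.ext_iff (b := 0)).symm
  have hW : ∀ c : ConjClasses G, IsOutside c → ∀ α : Fin k → Fin p,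
      W p ζ (fun j => (w j : G)) c α = charIdempotent (χ α) c := fun c hc α =>
    hG.W_eq_charIdempotent hZ hbij (hχ α) hc
  have hl := fun (c : ConjClasses G) (hc : IsOutside c) (α : Fin k → Fin p)
    (hα : ∃ j, (α j : ℕ) ≠ 0) => hG.mul_charIdempotent hZ ((hP α).mp hα) hc
  have hr := fun (c : ConjClasses G) (hc : IsOutside c) (α : Fin k → Fin p)
    (hα : ∃ j, (α j : ℕ) ≠ 0) => hG.charIdempotent_mul hZ ((hP α).mp hα) hc
  have he := hG.completeOrthogonalIdempotents_wedderburnIdempotent hZ hinj hP ⟨0, hχ0⟩ hsum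
  have hidem : IsIdempotentElem (primaryIdempotent : terwilligerAlgebra G) := he.idem none
  have hcomm : ∀ x : terwilligerAlgebra G, x * primaryIdempotent = primaryIdempotent * x :=
    hG.primaryIdempotent_comm hZ hP he
  refine ⟨⟨?_, ?_⟩, ?_⟩
  · rintro (_ | ⟨c, α⟩)
    · exact primaryComponent_minimal hidem hcomm
    · rw [components, WIdeal, hW _ c.2]
      exact minimal_span_singleton_asIdeal (charIdempotent_ne_zero _ _) (hl _ c.2 _ α.2)
        (hr _ c.2 _ α.2)
  · refine isInternal_of_completeOrthogonalIdempotents he ?_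
    rintro (_ | ⟨c, α⟩) x
    · exact mem_primaryComponent_iff hidem hcomm x
    · rw [components, WIdeal, hW _ c.2,
        mem_span_singleton_asIdeal_iff (hl _ c.2 _ α.2) (hr _ c.2 _ α.2)]
      constructor
      · rintro ⟨r, rfl⟩
        rw [smul_mul_assoc]
        exact congrArg _ (he.idem (some (c, α)))
      · intro hx
        obtain ⟨r, h⟩ := hl _ c.2 _ α.2 x
        exact ⟨r, hx.symm.trans h⟩
  · intro c hc α hα
    rw [WIdeal, hW c hc]
    exact finrank_span_singleton_asIdeal (charIdempotent_ne_zero _ _) (hl c hc α hα)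
      (hr c hc α hα)

end Wedderburn

end GroupScheme

end

theorem mainTheorem2 {G : Type*} [Group G] [Fintype G] [DecidableEq G] [Group.IsNilpotent G]
    (p n k : ℕ) (hp : p.Prime) (hG : Nat.card G = p ^ n)
    (hZ : Nat.card (Subgroup.center G) = p ^ k)
    (hcamina : GroupScheme.IsCamina G) (hclass : Group.nilpotencyClass G = 2) :
    Nat.card {c : ConjClasses G // GroupScheme.IsOutside c} = p ^ (n - k) - 1 ∧
    (∃ z : Fin k → G, Subgroup.closure (Set.range z) = Subgroup.center G) ∧
    ∀ z : Fin k → G, Subgroup.closure (Set.range z) = Subgroup.center G →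
    ∀ ζ : ℂ, IsPrimitiveRoot ζ p →
      GroupScheme.IsWedderburnDecomposition (GroupScheme.components p ζ z) ∧
      ∀ c : ConjClasses G, GroupScheme.IsOutside c →
        ∀ α : Fin k → Fin p, (∃ j, (α j : ℕ) ≠ 0) →
          Module.finrank ℂ (GroupScheme.WIdeal p ζ z c α) = 1 := by
  have : Fact p.Prime := ⟨hp⟩
  have hne := GroupScheme.commutator_ne_bot_of_nilpotencyClass hclass
  have heq : Subgroup.center G = commutator G := le_antisymm (hcamina.center_le_commutator hne)
    (GroupScheme.commutator_le_center_of_nilpotencyClass hclass)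
  have hout : ∃ g : G, g ∉ Subgroup.center G := by
    by_contra! h
    refine hne (eq_bot_iff.mpr (Subgroup.commutator_le.mpr fun a _ b _ => ?_))
    rw [Subgroup.mem_bot, commutatorElement_eq_one_iff_mul_comm]
    exact (Subgroup.mem_center_iff.mp (h a) b).symm
  have hexp : ∀ x : Subgroup.center G, x ^ p = 1 := fun x => Subtype.ext
    (hcamina.pow_eq_one_of_mem_center (IsPGroup.of_card hG) heq hout x.2)
  refine ⟨?_, ?_, fun z hz ζ hζ => ?_⟩
  · rw [hcamina.card_isOutside heq]
    have h1 := Subgroup.card_eq_card_quotient_mul_card_subgroup (Subgroup.center G)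
    -- Needed so that the truncated subtraction in `p ^ (n - k)` is a true one.
    have hkn : k ≤ n := (Nat.pow_dvd_pow_iff_le_right hp.one_lt).mp
      (hG ▸ hZ ▸ Subgroup.card_subgroup_dvd_card _)
    rw [hG, hZ, ← Nat.sub_add_cancel hkn, pow_add] at h1
    rw [← Nat.eq_of_mul_eq_mul_right (pow_pos hp.pos k) h1]
  · exact GroupScheme.exists_closure_range_eq_center hexp hZ
  · have hmem : ∀ j, z j ∈ Subgroup.center G := fun j =>
      hz ▸ Subgroup.subset_closure (Set.mem_range_self j)
    exact hcamina.isWedderburnDecomposition_components heq hexp hZ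
      (w := fun j => ⟨z j, hmem j⟩)
      ((GroupScheme.closure_range_coe_eq_center_iff fun j => ⟨z j, hmem j⟩).mp hz) hζ
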